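/- **Definitions.** A *Riesz space* is a partially ordered real vector space that is a lattice and whose order is compatible with the vector operations; $|u|=u\vee(-u)$, $X^+=\{u\in X: u\ge 0\}$. A partially ordered set is *Dedekind complete* (resp. *Dedekind $\sigma$-complete*) if every non-empty (resp. non-empty countable) subset with an upper bound has a supremum and every non-empty (resp. non-empty countable) subset with a lower bound has an infimum. A set is *order-bounded* if it has an upper and a lower bound. An *$f$-algebra* is a Riesz space with a bilinear, associative, commutative multiplication with identity $\mathbf 1$ such that $uv\ge 0$ for $u,v\ge 0$, and $(uw)\wedge v=0$ whenever $u\wedge v=0$ and $w\ge 0$. A *countable partition* of $\mathbf 1$ is a sequence $(u_n)_n$ of idempotents with $|u_n|\wedge|u_m|=0$ for $n\ne m$ and $\sup_n u_n=\mathbf 1$; a *simple element* is a finite sum $\sum_i\lambda_iu_i$ with $\lambda_i\in\mathbb R$ and $(u_i)_i$ a finite pairwise disjoint family of idempotents with $\sum_i u_i=\mathbf 1$. A Dedekind $\sigma$-complete $f$-algebra $X$ is *localisable* if its multiplication on $X^+\times X^+$ preserves suprema of non-decreasing sequences and infima of non-increasing sequences, whenever these exist, and every $x\in X^+$ is the supremum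 of a non-decreasing sequence of non-negative simple elements. A *metric Riesz space* is a Dedekind $\sigma$-complete Riesz space $X$ with a complete, translation-invariant distance $d_X$ such that $d_X(u,0)=d_X(|u|,0)$ for all $u\in X$, and $d_X(u,0)\le d_X(v,0)$ for $0\le u\le v$. A *metric $f$-algebra* is a localisable $f$-algebra $X$ that is a metric Riesz space, has continuous multiplication and dense simple elements, and satisfies $d_X(\varepsilon\mathbf 1,0)\to0$ as $\varepsilon\searrow0$. A *metric $f$-structure* $(\mathcal U,U,V)$ consists of a localisable $f$-algebra $\mathcal U$, a metric $f$-algebra $U$ that is a solid unital $f$-subalgebra of $\mathcal U$, and a metric Riesz space $V$ that is a solid Riesz subspace of $\mathcal U$ (a subset $S$ is *solid* if $|a|\le|b|$ and $b\in S$ imply $a\in S$), such that $UV=V$, the multiplication $U\times V\to V$ is continuous, and for each countable partition $(u_n)_n$ of $\mathbf 1_U$ and each $\varepsilon>0$ there is $\delta>0$ such that for every $(v_n)_n\subset V^+$ with $\sum_n d_V(u_nv_n,0)\le\delta$ the sequence $(u_nv_n)_n$ is order-bounded in $V$ and $d_V(\sup_nu_nv_n,0)\le\varepsilon$. A *$V$-normed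 $U$-module* is a $U$-module $\mathscr M$ with a map $|\cdot|:\mathscr M\to V^+$ such that $|v|=0\iff v=0$, $|v+w|\le|v|+|w|$, $|u\cdot v|=|u||v|$, and such that whenever $(u_n)_n$ is a countable partition of $\mathbf 1_U$, $(v_n)_n\subset\mathscr M$ and $(|u_n\cdot v_n|)_n$ is order-bounded in $V$, there is $v\in\mathscr M$ with $u_n\cdot v=u_n\cdot v_n$ for all $n$. It carries the distance $d_{\mathscr M}(v,w)=d_V(|v-w|,0)$ and is a *$V$-Banach $U$-module* if this distance is complete. For $V$-normed $U$-modules $\mathscr M,\mathscr N$, $\mathrm{Hom}(\mathscr M,\mathscr N)$ is the set of $U$-linear $T:\mathscr M\to\mathscr N$ such that, for some $w\in U^+$, $|Tv|\le w|v|$ for all $v\in\mathscr M$; when $U$ is Dedekind complete, $|T|\in U^+$ denotes the infimum in $U$ of all such $w$. An *isomorphism* of normed modules is a $U$-linear bijection $\Phi$ such that neither $\Phi$ nor $\Phi^{-1}$ increases the pointwise norm (equivalently, $|\Phi v|=|v|$ for all $v$). **Theorem (Completion of a normed module).** Let $(\mathcal U,U,V)$ be a metric $f$-structure. (i) For every $V$-normed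 $U$-module $\mathscr M$ there is a couple $(\bar{\mathscr M},\iota)$, called a *completion* of $\mathscr M$, where $\bar{\mathscr M}$ is a $V$-Banach $U$-module and $\iota:\mathscr M\to\bar{\mathscr M}$ is a $U$-linear map with dense range such that $|\iota v|=|v|$ for every $v\in\mathscr M$. (ii) It is unique up to unique isomorphism: if $(\bar{\mathscr M},\iota)$ and $(\tilde{\mathscr M},\tilde\iota)$ are completions of $\mathscr M$, there is a unique isomorphism $\Phi:\bar{\mathscr M}\to\tilde{\mathscr M}$ of $V$-Banach $U$-modules with $\Phi\circ\iota=\tilde\iota$. (iii) Let $\mathscr M,\mathscr N$ be $V$-normed $U$-modules with completions $(\bar{\mathscr M},\iota_{\mathscr M})$, $(\bar{\mathscr N},\iota_{\mathscr N})$, and let $T\in\mathrm{Hom}(\mathscr M,\mathscr N)$. Then there is a unique $\bar T\in\mathrm{Hom}(\bar{\mathscr M},\bar{\mathscr N})$ with $\bar T\circ\iota_{\mathscr M}=\iota_{\mathscr N}\circ T$. If in addition $U$ is Dedekind complete, then $|\bar T|=|T|$. -/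

import Mathlib

open Filter Topology
open scoped Pointwise

namespace FMod

/-! ### Order-theoretic notions -/

section Order

variable (P : Type*) [PartialOrder P]

/-- Dedekind `σ`-completeness of a partially ordered set. -/
def DedekindSigmaComplete : Prop :=
  (∀ s : Set P, s.Countable → s.Nonempty → BddAbove s → ∃ p, IsLUB s p) ∧
  (∀ s : Set P, s.Countable → s.Nonempty → BddBelow s → ∃ p, IsGLB s p)

/-- Dedekind completeness of a partially ordered set. -/
def DedekindComplete : Prop :=
  (∀ s : Set P, s.Nonempty → BddAbove s → ∃ p, IsLUB s p) ∧
  (∀ s : Set P, s.Nonempty → BddBelow s → ∃ p, IsGLB s p)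

end Order

/-- An order-bounded set: one that has an upper bound and a lower bound. -/
def OrderBounded {P : Type*} [PartialOrder P] (s : Set P) : Prop :=
  BddAbove s ∧ BddBelow s

/-! ### Riesz spaces and `f`-algebras -/

/-- A Riesz space: a real vector space with a compatible partial order that is a lattice. -/
structure IsRieszSpace (X : Type*) [AddCommGroup X] [Module ℝ X] [Lattice X] : Prop where
  add_le_add : ∀ u v w : X, u ≤ v → u + w ≤ v + w
  smul_nonneg : ∀ (c : ℝ) (u : X), 0 ≤ c → 0 ≤ u → 0 ≤ c • u

/-- A (commutative, unital) `f`-algebra. -/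
structure IsFAlgebra (X : Type*) [CommRing X] [Algebra ℝ X] [Lattice X] : Prop
    extends IsRieszSpace X where
  mul_nonneg : ∀ u v : X, 0 ≤ u → 0 ≤ v → 0 ≤ u * v
  mul_inf_eq_zero : ∀ u v w : X, u ⊓ v = 0 → 0 ≤ w → (u * w) ⊓ v = 0

section FAlgebra

variable (X : Type*) [CommRing X] [Algebra ℝ X] [Lattice X]

/-- The multiplication `X⁺ × X⁺ → X` is `σ`-order-continuous. -/
def MulSigmaOrderContinuous : Prop :=
  (∀ (a b : ℕ → X) (x y : X), (∀ n, 0 ≤ a n) → (∀ n, 0 ≤ b n) → Monotone a → Monotone b →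
    IsLUB (Set.range a) x → IsLUB (Set.range b) y →
    IsLUB (Set.range fun n => a n * b n) (x * y)) ∧
  (∀ (a b : ℕ → X) (x y : X), (∀ n, 0 ≤ a n) → (∀ n, 0 ≤ b n) → Antitone a → Antitone b →
    IsGLB (Set.range a) x → IsGLB (Set.range b) y →
    IsGLB (Set.range fun n => a n * b n) (x * y))

variable {X}

/-- A finite partition of `e`: a finite disjoint family of idempotents whose sum is `e`. -/
def IsFinitePartition {n : ℕ} (u : Fin n → X) (e : X) : Prop :=
  (∀ i, IsIdempotentElem (u i)) ∧ (∀ i j, i ≠ j → |u i| ⊓ |u j| = 0) ∧ ∑ i, u i = e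

/-- A countable partition of `e`: a disjoint sequence of idempotents whose supremum is `e`. -/
def IsCountablePartition (u : ℕ → X) (e : X) : Prop :=
  (∀ n, IsIdempotentElem (u n)) ∧ (∀ m n, m ≠ n → |u m| ⊓ |u n| = 0) ∧ IsLUB (Set.range u) e

variable (X)

/-- The simple elements of an `f`-algebra. -/
def simpleElements : Set X :=
  {x | ∃ (n : ℕ) (c : Fin n → ℝ) (u : Fin n → X), IsFinitePartition u 1 ∧ x = ∑ i, c i • u i}

/-- A localisable `f`-algebra. -/
structure IsLocalisable : Prop extends IsFAlgebra X where
  sigmaComplete : DedekindSigmaComplete X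
  mul_sigmaOrderContinuous : MulSigmaOrderContinuous X
  superOrderDense : ∀ x : X, 0 ≤ x → ∃ s : ℕ → X,
    (∀ n, s n ∈ simpleElements X ∧ 0 ≤ s n) ∧ Monotone s ∧ IsLUB (Set.range s) x

end FAlgebra

/-! ### Metric Riesz spaces and metric `f`-algebras -/

/-- A metric Riesz space. -/
structure IsMetricRiesz (X : Type*) [AddCommGroup X] [Module ℝ X] [Lattice X] [MetricSpace X] :
    Prop extends IsRieszSpace X where
  sigmaComplete : DedekindSigmaComplete X
  complete : CompleteSpace X
  dist_abs : ∀ u : X, dist u 0 = dist |u| 0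
  dist_add : ∀ u v w : X, dist u v = dist (u + w) (v + w)
  dist_mono : ∀ u v : X, 0 ≤ u → u ≤ v → dist u 0 ≤ dist v 0

/-- A metric `f`-algebra. -/
structure IsMetricFAlgebra (X : Type*) [CommRing X] [Algebra ℝ X] [Lattice X] [MetricSpace X] :
    Prop where
  localisable : IsLocalisable X
  metricRiesz : IsMetricRiesz X
  continuous_mul : Continuous fun p : X × X => p.1 * p.2
  dense_simple : Dense (simpleElements X)
  tendsto_smul_one : Tendsto (fun ε : ℝ => dist (ε • (1 : X)) 0) (𝓝[>] 0) (𝓝 0)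

/-! ### Riesz subspaces and `f`-subalgebras -/

section Sub

variable (A : Type*) [CommRing A] [Algebra ℝ A] [Lattice A]

/-- A Riesz subspace of `A`: a linear subspace that is a sublattice. -/
structure RieszSubspace extends Submodule ℝ A where
  sup_mem' : ∀ {a b : A}, a ∈ carrier → b ∈ carrier → a ⊔ b ∈ carrier
  inf_mem' : ∀ {a b : A}, a ∈ carrier → b ∈ carrier → a ⊓ b ∈ carrier

/-- An `f`-subalgebra of `A`: a unital subalgebra that is a sublattice. -/
structure FSubalgebra extends Subalgebra ℝ A where
  sup_mem' : ∀ {a b : A}, a ∈ carrier → b ∈ carrier → a ⊔ b ∈ carrier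
  inf_mem' : ∀ {a b : A}, a ∈ carrier → b ∈ carrier → a ⊓ b ∈ carrier

variable {A}

instance : SetLike (RieszSubspace A) A where
  coe V := V.carrier
  coe_injective := by
    rintro ⟨V, _, _⟩ ⟨W, _, _⟩ h
    have h' : V = W := SetLike.coe_injective h
    subst h'
    rfl

instance : AddSubgroupClass (RieszSubspace A) A where
  add_mem {V} {_ _} ha hb := V.add_mem' ha hb
  zero_mem V := V.zero_mem'
  neg_mem {V} {_} ha := V.toSubmodule.neg_mem ha

instance : SMulMemClass (RieszSubspace A) ℝ A where
  smul_mem {V} c {_} ha := V.smul_mem' c ha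

instance (V : RieszSubspace A) : Lattice V :=
  Subtype.lattice (fun {_ _} ha hb => V.sup_mem' ha hb) (fun {_ _} ha hb => V.inf_mem' ha hb)

instance : SetLike (FSubalgebra A) A where
  coe U := U.carrier
  coe_injective := by
    rintro ⟨V, _, _⟩ ⟨W, _, _⟩ h
    have h' : V = W := SetLike.coe_injective h
    subst h'
    rfl

instance : SubringClass (FSubalgebra A) A where
  add_mem {U} {_ _} ha hb := U.add_mem' ha hb
  zero_mem U := U.zero_mem'
  neg_mem {U} {_} ha := U.toSubalgebra.neg_mem ha
  mul_mem {U} {_ _} ha hb := U.mul_mem' ha hb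
  one_mem U := U.one_mem'

instance : SMulMemClass (FSubalgebra A) ℝ A where
  smul_mem {U} c {_} ha := U.toSubalgebra.smul_mem ha c

instance (U : FSubalgebra A) : Lattice U :=
  Subtype.lattice (fun {_ _} ha hb => U.sup_mem' ha hb) (fun {_ _} ha hb => U.inf_mem' ha hb)

/-- A subset `S` of `A` is solid. -/
def Solid (S : Set A) : Prop := ∀ a : A, ∀ b ∈ S, |a| ≤ |b| → a ∈ S

/-- The product of an element of `U` and an element of `V`, as an element of `V` when `UV = V`. -/
def act {U : FSubalgebra A} {V : RieszSubspace A} (h : (U : Set A) * (V : Set A) = (V : Set A))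
    (u : U) (v : V) : V :=
  ⟨(u : A) * (v : A), h.subset (Set.mul_mem_mul u.2 v.2)⟩

end Sub

/-! ### Metric `f`-structures -/

/-- A metric `f`-structure `(A, U, V)` with ambient algebra `A`. -/
structure MetricFStructure (A : Type*) [CommRing A] [Algebra ℝ A] [Lattice A] where
  localisable : IsLocalisable A
  U : FSubalgebra A
  V : RieszSubspace A
  metricU : MetricSpace U
  metricV : MetricSpace V
  metricFAlgebra : IsMetricFAlgebra U
  solidU : Solid (U : Set A)
  metricRiesz : IsMetricRiesz V
  solidV : Solid (V : Set A)
  mul_eq : (U : Set A) * (V : Set A) = (V : Set A)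
  continuous_act : Continuous fun p : U × V => act mul_eq p.1 p.2
  gluing : ∀ u : ℕ → U, IsCountablePartition u 1 → ∀ ε : ℝ, 0 < ε → ∃ δ : ℝ, 0 < δ ∧
    ∀ v : ℕ → V, (∀ n, 0 ≤ v n) →
      Summable (fun n => dist (act mul_eq (u n) (v n)) 0) →
      ∑' n, dist (act mul_eq (u n) (v n)) 0 ≤ δ →
      OrderBounded (Set.range fun n => act mul_eq (u n) (v n)) ∧
      ∃ s : V, IsLUB (Set.range fun n => act mul_eq (u n) (v n)) s ∧ dist s 0 ≤ ε

attribute [instance] MetricFStructure.metricU MetricFStructure.metricV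

/-! ### Normed modules -/

section Modules

variable {A : Type*} [CommRing A] [Algebra ℝ A] [Lattice A]

/-- A `V`-normed `U`-module over a metric `f`-structure `S = (A, U, V)`; `pnorm` is the
`V`-pointwise norm. -/
structure NormedMod (S : MetricFStructure A) where
  carrier : Type*
  [addCommGroup : AddCommGroup carrier]
  [module : Module S.U carrier]
  pnorm : carrier → S.V
  pnorm_nonneg : ∀ v, 0 ≤ pnorm v
  pnorm_eq_zero_iff : ∀ v, pnorm v = 0 ↔ v = 0
  pnorm_add_le : ∀ v w, pnorm (v + w) ≤ pnorm v + pnorm w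
  pnorm_smul : ∀ (u : S.U) v, pnorm (u • v) = act S.mul_eq |u| (pnorm v)
  gluing : ∀ (u : ℕ → S.U) (v : ℕ → carrier), IsCountablePartition u 1 →
    OrderBounded (Set.range fun n => pnorm (u n • v n)) →
    ∃ w : carrier, ∀ n, u n • w = u n • v n

variable {S : MetricFStructure A}

instance : CoeSort (NormedMod S) (Type _) := ⟨NormedMod.carrier⟩

attribute [instance] NormedMod.addCommGroup NormedMod.module

namespace NormedMod

theorem pnorm_neg (M : NormedMod S) (v : M) : M.pnorm (-v) = M.pnorm v := by
  have h := M.pnorm_smul (-1) v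
  have h2 := M.pnorm_smul 1 v
  have h3 : |(-1 : S.U)| = |(1 : S.U)| := by
    simp [abs, sup_comm]
  rw [h3, ← h2] at h
  simpa using h

theorem dist_pnorm_triangle (M : NormedMod S) (a b c : M) :
    dist (M.pnorm (a - c)) 0 ≤ dist (M.pnorm (a - b)) 0 + dist (M.pnorm (b - c)) 0 := by
  have h1 : M.pnorm (a - c) ≤ M.pnorm (a - b) + M.pnorm (b - c) := by
    have h := M.pnorm_add_le (a - b) (b - c)
    rwa [sub_add_sub_cancel] at h
  have h2 := S.metricRiesz.dist_mono _ _ (M.pnorm_nonneg _) h1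
  have h3 := dist_triangle (M.pnorm (a - b) + M.pnorm (b - c)) (M.pnorm (b - c)) 0
  have h4 := S.metricRiesz.dist_add (M.pnorm (a - b)) 0 (M.pnorm (b - c))
  rw [zero_add] at h4
  linarith

/-- The distance `d(v, w) = d_V(|v - w|, 0)` of a normed module. -/
noncomputable instance (M : NormedMod S) : MetricSpace M where
  dist v w := dist (M.pnorm (v - w)) 0
  dist_self v := by
    have h : M.pnorm (v - v) = 0 := (M.pnorm_eq_zero_iff _).2 (sub_self v)
    rw [h, dist_self]
  dist_comm v w := by
    rw [← neg_sub v w, pnorm_neg]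
  dist_triangle a b c := M.dist_pnorm_triangle a b c
  eq_of_dist_eq_zero {v w} h :=
    sub_eq_zero.1 ((M.pnorm_eq_zero_iff _).1 (eq_of_dist_eq_zero h))

/-- A `V`-Banach `U`-module is a `V`-normed `U`-module that is complete for its distance. -/
def IsBanach (M : NormedMod S) : Prop := CompleteSpace M

end NormedMod

/-! ### Homomorphisms -/

/-- The elements `w ∈ U⁺` such that `|T v| ≤ w |v|` for every `v`. -/
def boundSet {M N : NormedMod S} (T : M →ₗ[S.U] N) : Set S.U :=
  {w | 0 ≤ w ∧ ∀ v : M, N.pnorm (T v) ≤ act S.mul_eq w (M.pnorm v)}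

/-- `Hom(M, N)`: the `U`-linear maps `T : M → N` with `|T v| ≤ w |v|` for some `w ∈ U⁺`. -/
structure Hom (M N : NormedMod S) where
  toLin : M →ₗ[S.U] N
  bounded : (boundSet toLin).Nonempty

theorem Hom.exists_isGLB {M N : NormedMod S} (hU : DedekindComplete S.U) (T : Hom M N) :
    ∃ w, IsGLB (boundSet T.toLin) w :=
  hU.2 _ T.bounded ⟨0, fun _ hw => hw.1⟩

/-- The pointwise norm `|T| ∈ U⁺` of a homomorphism, for `U` Dedekind complete: the infimum of
all `w ∈ U⁺` such that `|T v| ≤ w |v|` for every `v`. -/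
noncomputable def Hom.pnorm {M N : NormedMod S} (hU : DedekindComplete S.U) (T : Hom M N) : S.U :=
  (T.exists_isGLB hU).choose

theorem Hom.isGLB_pnorm {M N : NormedMod S} (hU : DedekindComplete S.U) (T : Hom M N) :
    IsGLB (boundSet T.toLin) (T.pnorm hU) :=
  (T.exists_isGLB hU).choose_spec

/-- A `U`-linear bijection is an isomorphism of normed modules when it and its inverse are
morphisms of the category of normed modules, i.e. do not increase the pointwise norm. -/
def IsNormedModIso {M N : NormedMod S} (Φ : M ≃ₗ[S.U] N) : Prop :=
  (∀ v : M, N.pnorm (Φ v) ≤ M.pnorm v) ∧ (∀ w : N, M.pnorm (Φ.symm w) ≤ N.pnorm w)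

/-- `(B, ι)` is a completion of `M`: `B` is Banach, and the `U`-linear map `ι : M → B` has dense
range and preserves the pointwise norm. -/
structure IsCompletion (M B : NormedMod S) (ι : M →ₗ[S.U] B) : Prop where
  banach : B.IsBanach
  denseRange : DenseRange ι
  pnorm_map : ∀ v : M, B.pnorm (ι v) = M.pnorm v

end Modules

end FMod

open FMod

universe a m n b c

namespace FMod

/-! ### Idempotents and order in `f`-algebras. -/

section FAlgebra

/-! The completion is the metric completion, with the 1-Lipschitz pointwise norm extended by
continuity. The order of `V` is closed, so the norm axioms pass from `M` by density. Gluing is not a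
closed condition and is the real work. Given locally prescribed data in the completion, approximate
the `n`-th piece by an element of `M`, with errors summable in `n`. The gluing axiom of the
`f`-structure dominates all errors by one small `s`, so the approximants are order-bounded and glue
inside `M` (`exists_approx_glue`). Two such approximations differ by at most the sum of their bounds
on every piece, hence globally (`le_of_forall_act_le`, which rests on the `σ`-order-continuity of
the ambient multiplication). They are therefore Cauchy, and the limit is the required element
(`completion_gluing`). Uniqueness and functoriality are extension by density: a pointwise bound by
`w` is a closed condition, so it survives with the same `w` (`bound_of_bound`). Hence a map and its
extension have the same set of bounds (`boundSet_eq`). -/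

theorem IsRieszSpace.isOrderedAddMonoid {X : Type*} [AddCommGroup X] [Module ℝ X] [Lattice X]
    (h : IsRieszSpace X) : IsOrderedAddMonoid X where
  add_le_add_left u v huv w := h.add_le_add u v w huv

variable {X : Type*} [CommRing X] [Algebra ℝ X] [Lattice X]

/-- The `f`-algebra axiom applied twice makes `u * v` disjoint first from `v`, then from itself. -/
theorem IsFAlgebra.mul_eq_zero_of_inf_eq_zero (h : IsFAlgebra X) {u v : X}
    (hu : 0 ≤ u) (hv : 0 ≤ v) (huv : u ⊓ v = 0) : u * v = 0 := by
  have h1 : v ⊓ (u * v) = 0 := by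
    rw [inf_comm]
    exact h.mul_inf_eq_zero u v v huv hv
  have h2 := h.mul_inf_eq_zero v (u * v) u h1 hu
  rwa [mul_comm v u, inf_idem] at h2

theorem IsFAlgebra.mul_self_nonneg (h : IsFAlgebra X) (u : X) : 0 ≤ u * u := by
  have := h.toIsRieszSpace.isOrderedAddMonoid
  have h0 : u⁺ * u⁻ = 0 :=
    h.mul_eq_zero_of_inf_eq_zero (posPart_nonneg u) (negPart_nonneg u)
      (posPart_inf_negPart_eq_zero u)
  have h1 : u * u = u⁺ * u⁺ + u⁻ * u⁻ := by
    nth_rewrite 1 2 [← posPart_sub_negPart u]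
    linear_combination (-2 : X) * h0
  rw [h1]
  exact add_nonneg (h.mul_nonneg _ _ (posPart_nonneg u) (posPart_nonneg u))
    (h.mul_nonneg _ _ (negPart_nonneg u) (negPart_nonneg u))

theorem IsFAlgebra.idempotent_nonneg (h : IsFAlgebra X) {u : X} (hu : IsIdempotentElem u) :
    0 ≤ u := by
  rw [← hu.eq]
  exact h.mul_self_nonneg u

theorem IsFAlgebra.mul_le_mul_left (h : IsFAlgebra X) {u x y : X} (hu : 0 ≤ u) (hxy : x ≤ y) :
    u * x ≤ u * y := by
  have := h.toIsRieszSpace.isOrderedAddMonoid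
  have := h.mul_nonneg u (y - x) hu (sub_nonneg.2 hxy)
  rwa [mul_sub, sub_nonneg] at this

theorem IsFAlgebra.orthogonalIdempotents (h : IsFAlgebra X) {u : ℕ → X} {e : X}
    (hu : IsCountablePartition u e) : OrthogonalIdempotents u where
  idem := hu.1
  ortho m n hmn := by
    have := h.toIsRieszSpace.isOrderedAddMonoid
    have := hu.2.1 m n hmn
    rw [abs_of_nonneg (h.idempotent_nonneg (hu.1 m)),
      abs_of_nonneg (h.idempotent_nonneg (hu.1 n))] at this
    exact h.mul_eq_zero_of_inf_eq_zero (h.idempotent_nonneg (hu.1 m))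
      (h.idempotent_nonneg (hu.1 n)) this

/-- Order can be tested locally on a countable partition of the unit. -/
theorem IsLocalisable.le_of_forall_mul_le (h : IsLocalisable X) {u : ℕ → X}
    (hu : IsCountablePartition u 1) {x y : X} (hx : 0 ≤ x) (hy : 0 ≤ y)
    (hxy : ∀ n, u n * x ≤ y) : x ≤ y := by
  have := h.toIsFAlgebra.toIsRieszSpace.isOrderedAddMonoid
  have hf := h.toIsFAlgebra
  have ho := hf.orthogonalIdempotents hu
  have hu0 : ∀ n, 0 ≤ u n := fun n => hf.idempotent_nonneg (hu.1 n)
  -- The partial sums are idempotents increasing to `1`, so `a n * x` increases to `x` and it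
  -- suffices to bound each `a n * x` by `y`.
  set a : ℕ → X := fun n => ∑ i ∈ Finset.range n, u i with ha
  have ha0 : ∀ n, 0 ≤ a n := fun n => Finset.sum_nonneg fun i _ => hu0 i
  have ha1 : ∀ n, a n ≤ 1 := fun n =>
    sub_nonneg.1 (hf.idempotent_nonneg (ho.isIdempotentElem_sum (s := Finset.range n)).one_sub)
  have hmono : Monotone a := monotone_nat_of_le_succ fun n => by
    simp only [ha, Finset.sum_range_succ]
    exact le_add_of_nonneg_right (hu0 n)
  have hlub : IsLUB (Set.range a) 1 := by
    refine ⟨?_, fun b hb => hu.2.2.2 ?_⟩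
    · rintro _ ⟨n, rfl⟩
      exact ha1 n
    · rintro _ ⟨n, rfl⟩
      refine le_trans ?_ (hb ⟨n + 1, rfl⟩)
      simp only [ha, Finset.sum_range_succ]
      exact le_add_of_nonneg_left (ha0 n)
  have hsup := h.mul_sigmaOrderContinuous.1 a (fun _ => x) 1 x ha0 (fun _ => hx) hmono
    monotone_const hlub (by simp)
  rw [one_mul] at hsup
  refine hsup.2 ?_
  rintro _ ⟨n, rfl⟩
  -- Idempotence keeps a spare factor `u i` after the local bound is used, so the sum is at most `a
  -- n * y` rather than `n` copies of `y`.
  calc a n * x = ∑ i ∈ Finset.range n, u i * (u i * x) := by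
        simp only [ha, Finset.sum_mul, ← mul_assoc, (hu.1 _).eq]
    _ ≤ ∑ i ∈ Finset.range n, u i * y :=
        Finset.sum_le_sum fun i _ => hf.mul_le_mul_left (hu0 i) (hxy i)
    _ = y * a n := by rw [← Finset.sum_mul, mul_comm]
    _ ≤ y * 1 := hf.mul_le_mul_left hy (ha1 n)
    _ = y := mul_one y

end FAlgebra

/-! ### Metric Riesz spaces -/

namespace IsMetricRiesz

variable {X : Type*} [AddCommGroup X] [Module ℝ X] [Lattice X] [MetricSpace X]

theorem dist_eq_dist_sub (h : IsMetricRiesz X) (x y : X) : dist x y = dist (x - y) 0 := by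
  rw [h.dist_add x y (-y), add_neg_cancel, sub_eq_add_neg]

theorem dist_add_zero_le (h : IsMetricRiesz X) (x y : X) :
    dist (x + y) 0 ≤ dist x 0 + dist y 0 := by
  have h1 := dist_triangle (x + y) y 0
  have h2 := h.dist_add x 0 y
  rw [zero_add] at h2
  linarith

theorem isUniformAddGroup (h : IsMetricRiesz X) : IsUniformAddGroup X := by
  refine ⟨Metric.uniformContinuous_iff.2 fun ε hε => ⟨ε / 2, half_pos hε, fun {p q} hpq => ?_⟩⟩
  rw [Prod.dist_eq, max_lt_iff] at hpq
  have h1 := h.dist_add p.1 q.1 (-p.2)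
  -- Translation by `-p.2 - q.2` turns the pair into `-q.2`, `-p.2`: negation is an isometry.
  have h2 := h.dist_add p.2 q.2 (-p.2 - q.2)
  rw [show p.2 + (-p.2 - q.2) = -q.2 by abel, show q.2 + (-p.2 - q.2) = -p.2 by abel] at h2
  have h3 := h.dist_add (-p.2) (-q.2) q.1
  have h4 := dist_triangle (p.1 + -p.2) (q.1 + -p.2) (q.1 + -q.2)
  rw [add_comm (-p.2), add_comm (-q.2)] at h3
  rw [dist_comm (-q.2)] at h2
  rw [sub_eq_add_neg, sub_eq_add_neg]
  linarith [hpq.1, hpq.2]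

theorem dist_le_dist_of_abs_le (h : IsMetricRiesz X) {x y : X} (hxy : |x| ≤ y) :
    dist x 0 ≤ dist y 0 := by
  have := h.toIsRieszSpace.isOrderedAddMonoid
  rw [h.dist_abs x]
  exact h.dist_mono _ _ (abs_nonneg x) hxy

theorem continuous_abs (h : IsMetricRiesz X) : Continuous fun x : X => |x| := by
  have := h.toIsRieszSpace.isOrderedAddMonoid
  refine (LipschitzWith.of_dist_le_mul (K := 1) fun x y => ?_).continuous
  rw [NNReal.coe_one, one_mul, h.dist_eq_dist_sub, h.dist_eq_dist_sub x y, h.dist_abs (x - y)]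
  exact h.dist_le_dist_of_abs_le (abs_abs_sub_abs_le x y)

/-- The order relation is the equation `|q - p| = q - p` between continuous functions. -/
theorem orderClosedTopology (h : IsMetricRiesz X) : OrderClosedTopology X where
  isClosed_le' := by
    have := h.toIsRieszSpace.isOrderedAddMonoid
    have := h.isUniformAddGroup
    have : {p : X × X | p.1 ≤ p.2} = {p | |p.2 - p.1| = p.2 - p.1} := by
      ext p
      refine ⟨fun hp => abs_of_nonneg (sub_nonneg.2 hp), fun hp => ?_⟩
      have hp : |p.2 - p.1| = p.2 - p.1 := hp
      have := abs_nonneg (p.2 - p.1)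
      rw [hp] at this
      exact sub_nonneg.1 this
    rw [this]
    exact isClosed_eq (h.continuous_abs.comp (by fun_prop)) (by fun_prop)

end IsMetricRiesz

/-! ### Metric `f`-structures -/

section Structure

variable {A : Type*} [CommRing A] [Algebra ℝ A] [Lattice A] (S : MetricFStructure A)

instance : IsOrderedAddMonoid S.V := S.metricRiesz.toIsRieszSpace.isOrderedAddMonoid

instance : IsOrderedAddMonoid S.U := S.metricFAlgebra.metricRiesz.toIsRieszSpace.isOrderedAddMonoid

instance : IsUniformAddGroup S.V := S.metricRiesz.isUniformAddGroup

instance : OrderClosedTopology S.V := S.metricRiesz.orderClosedTopology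

instance : CompleteSpace S.V := S.metricRiesz.complete

variable {S}

theorem act_zero (u : S.U) : act S.mul_eq u 0 = 0 :=
  Subtype.ext (mul_zero (u : A))

theorem one_act (v : S.V) : act S.mul_eq 1 v = v :=
  Subtype.ext (one_mul (v : A))

theorem continuous_act_left (u : S.U) : Continuous fun v : S.V => act S.mul_eq u v :=
  S.continuous_act.comp (Continuous.prodMk_right u)

theorem partition_nonneg {u : ℕ → S.U} {e : S.U} (hu : IsCountablePartition u e) (n : ℕ) :
    0 ≤ u n :=
  S.metricFAlgebra.localisable.toIsFAlgebra.idempotent_nonneg (hu.1 n)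

/-- A supremum taken in `U` could fail to be one in `A`. Solidity prevents this: an upper bound `b`
in `A` can be replaced by `b ⊓ 1`, which lies in `U`. -/
theorem partition_coe {u : ℕ → S.U} (hu : IsCountablePartition u 1) :
    IsCountablePartition (fun n => (u n : A)) 1 := by
  have := S.localisable.toIsFAlgebra.toIsRieszSpace.isOrderedAddMonoid
  refine ⟨fun n => congrArg Subtype.val (hu.1 n), fun m n h =>
    congrArg Subtype.val (hu.2.1 m n h), ?_, fun b hb => ?_⟩
  · rintro _ ⟨n, rfl⟩
    exact hu.2.2.1 ⟨n, rfl⟩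
  · have h1 : (0 : A) ≤ 1 :=
      S.localisable.toIsFAlgebra.idempotent_nonneg IsIdempotentElem.one
    have h0 : (0 : A) ≤ b := le_trans (partition_nonneg hu 0) (hb ⟨0, rfl⟩)
    have hmem : b ⊓ 1 ∈ (S.U : Set A) := by
      refine S.solidU _ 1 (one_mem S.U) ?_
      rw [abs_of_nonneg (le_inf h0 h1), abs_of_nonneg h1]
      exact inf_le_right
    have h2 : (1 : S.U) ≤ ⟨b ⊓ 1, hmem⟩ := by
      refine hu.2.2.2 ?_
      rintro _ ⟨n, rfl⟩
      exact le_inf (hb ⟨n, rfl⟩) (hu.2.2.1 ⟨n, rfl⟩)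
    exact le_trans (show (1 : A) ≤ b ⊓ 1 from h2) inf_le_left

/-- `V` has no multiplication of its own, so the comparison takes place in `A`. -/
theorem le_of_forall_act_le {u : ℕ → S.U} (hu : IsCountablePartition u 1) {x y : S.V}
    (hx : 0 ≤ x) (hy : 0 ≤ y) (h : ∀ n, act S.mul_eq (u n) x ≤ y) : x ≤ y :=
  S.localisable.le_of_forall_mul_le (partition_coe hu) (x := (x : A)) (y := (y : A)) hx hy h

end Structure

/-! ### Topology of normed modules -/

namespace NormedMod

variable {A : Type*} [CommRing A] [Algebra ℝ A] [Lattice A] {S : MetricFStructure A}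
variable (M : NormedMod S)

theorem dist_def (v w : M) : dist v w = dist (M.pnorm (v - w)) 0 := rfl

theorem pnorm_zero : M.pnorm 0 = 0 := (M.pnorm_eq_zero_iff 0).2 rfl

theorem pnorm_sub_le (v w : M) : M.pnorm (v - w) ≤ M.pnorm v + M.pnorm w := by
  simpa [sub_eq_add_neg, pnorm_neg] using M.pnorm_add_le v (-w)

theorem abs_pnorm_sub_pnorm_le (v w : M) : |M.pnorm v - M.pnorm w| ≤ M.pnorm (v - w) := by
  refine abs_le'.2 ⟨?_, ?_⟩
  · simpa [sub_le_iff_le_add] using M.pnorm_add_le (v - w) w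
  · have := M.pnorm_add_le (w - v) v
    rw [sub_add_cancel, ← M.pnorm_neg (w - v), neg_sub] at this
    simpa [sub_le_iff_le_add] using this

theorem lipschitzWith_pnorm : LipschitzWith 1 M.pnorm :=
  LipschitzWith.of_dist_le_mul fun v w => by
    rw [NNReal.coe_one, one_mul, dist_def, S.metricRiesz.dist_eq_dist_sub]
    exact S.metricRiesz.dist_le_dist_of_abs_le (M.abs_pnorm_sub_pnorm_le v w)

theorem continuous_pnorm : Continuous M.pnorm := M.lipschitzWith_pnorm.continuous

instance : IsUniformAddGroup M := by
  refine ⟨Metric.uniformContinuous_iff.2 fun ε hε => ⟨ε / 2, half_pos hε, fun {p q} hpq => ?_⟩⟩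
  rw [Prod.dist_eq, max_lt_iff] at hpq
  have h1 : M.pnorm (p.1 - p.2 - (q.1 - q.2)) ≤ M.pnorm (p.1 - q.1) + M.pnorm (p.2 - q.2) := by
    rw [sub_sub_sub_comm]
    exact M.pnorm_sub_le _ _
  have h2 := S.metricRiesz.dist_mono _ _ (M.pnorm_nonneg _) h1
  have h3 := S.metricRiesz.dist_add_zero_le (M.pnorm (p.1 - q.1)) (M.pnorm (p.2 - q.2))
  simp only [dist_def] at hpq ⊢
  linarith [hpq.1, hpq.2]

/-- A linear map bounded in pointwise norm is continuous. -/
theorem continuous_of_bound {M N : NormedMod S} (T : M →ₗ[S.U] N) (w : S.U)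
    (h : ∀ v, N.pnorm (T v) ≤ act S.mul_eq w (M.pnorm v)) : Continuous T := by
  refine continuous_of_continuousAt_zero T ?_
  rw [ContinuousAt, map_zero, tendsto_iff_dist_tendsto_zero]
  have hc : Tendsto (fun v : M => dist (act S.mul_eq w (M.pnorm v)) 0) (𝓝 0) (𝓝 0) := by
    have : Continuous fun v : M => dist (act S.mul_eq w (M.pnorm v)) 0 :=
      ((continuous_act_left w).comp M.continuous_pnorm).dist continuous_const
    simpa [pnorm_zero, act_zero] using this.tendsto 0
  refine squeeze_zero (fun _ => dist_nonneg) (fun v => ?_) hc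
  rw [dist_def, sub_zero]
  exact S.metricRiesz.dist_mono _ _ (N.pnorm_nonneg _) (h v)

/-- This lets the scalar action extend to `Completion M`. -/
instance : UniformContinuousConstSMul S.U M where
  uniformContinuous_const_smul u :=
    uniformContinuous_addMonoidHom_of_continuous (f := DistribSMul.toAddMonoidHom M u)
      (continuous_of_bound (LinearMap.lsmul S.U M u) |u| fun v => (M.pnorm_smul u v).le)

end NormedMod

namespace NormedMod

variable {A : Type a} [CommRing A] [Algebra ℝ A] [Lattice A] {S : MetricFStructure A}
variable (M : NormedMod.{a, m} S)

open UniformSpace (Completion)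

/-! ### The pointwise norm on the metric completion -/

/-- The extension of the pointwise norm to the metric completion. -/
noncomputable def completionPnorm : Completion M → S.V := Completion.extension M.pnorm

@[simp]
theorem completionPnorm_coe (v : M) : M.completionPnorm (v : Completion M) = M.pnorm v :=
  Completion.extension_coe M.lipschitzWith_pnorm.uniformContinuous v

theorem continuous_completionPnorm : Continuous M.completionPnorm :=
  Completion.continuous_extension

theorem completionPnorm_nonneg (v : Completion M) : 0 ≤ M.completionPnorm v := by
  induction v using Completion.induction_on with
  | hp => exact isClosed_le continuous_const M.continuous_completionPnorm
  | ih v => simpa using M.pnorm_nonneg v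

theorem completionPnorm_add_le (v w : Completion M) :
    M.completionPnorm (v + w) ≤ M.completionPnorm v + M.completionPnorm w := by
  have := M.continuous_completionPnorm
  induction v, w using Completion.induction_on₂ with
  | hp => exact isClosed_le (by fun_prop) (by fun_prop)
  | ih v w =>
    rw [← Completion.coe_add]
    simpa using M.pnorm_add_le v w

theorem completionPnorm_smul (u : S.U) (v : Completion M) :
    M.completionPnorm (u • v) = act S.mul_eq |u| (M.completionPnorm v) := by
  induction v using Completion.induction_on with
  | hp =>
    exact isClosed_eq (M.continuous_completionPnorm.comp (continuous_const_smul u))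
      ((continuous_act_left |u|).comp M.continuous_completionPnorm)
  | ih v =>
    rw [← Completion.coe_smul, completionPnorm_coe, completionPnorm_coe, M.pnorm_smul]

/-- Definiteness of the extended norm is not a closed condition; it comes from this identity and the
separation of the metric. -/
theorem completion_dist_eq (v w : Completion M) :
    dist v w = dist (M.completionPnorm (v - w)) 0 := by
  have := M.continuous_completionPnorm
  induction v, w using Completion.induction_on₂ with
  | hp => exact isClosed_eq (by fun_prop) (by fun_prop)
  | ih v w =>
    rw [← Completion.coe_sub, completionPnorm_coe, Completion.dist_eq, dist_def]

theorem completionPnorm_eq_zero_iff (v : Completion M) : M.completionPnorm v = 0 ↔ v = 0 := by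
  rw [← dist_eq_zero, ← dist_eq_zero (x := v), completion_dist_eq, sub_zero]

theorem completionPnorm_sub_comm (v w : Completion M) :
    M.completionPnorm (v - w) = M.completionPnorm (w - v) := by
  have := M.continuous_completionPnorm
  induction v, w using Completion.induction_on₂ with
  | hp => exact isClosed_eq (by fun_prop) (by fun_prop)
  | ih v w =>
    rw [← Completion.coe_sub, ← Completion.coe_sub, completionPnorm_coe, completionPnorm_coe,
      ← M.pnorm_neg, neg_sub]

theorem completionPnorm_smul_of_nonneg {u : S.U} (hu : 0 ≤ u) (v : Completion M) :
    M.completionPnorm (u • v) = act S.mul_eq u (M.completionPnorm v) := by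
  rw [completionPnorm_smul, abs_of_nonneg hu]

theorem continuous_completionPnorm_smul_sub (u : S.U) (v : Completion M) :
    Continuous fun z : Completion M => M.completionPnorm (u • (v - z)) :=
  M.continuous_completionPnorm.comp ((continuous_const_smul u).comp (continuous_sub_left v))

/-! ### Gluing in the metric completion. -/

variable {M}

/-- A locally given, order-bounded family in the completion is uniformly close to a single element
of the module. -/
theorem exists_approx_glue {u : ℕ → S.U} (hu : IsCountablePartition u 1) (v : ℕ → Completion M)
    {y : S.V} (hy : ∀ n, M.completionPnorm (u n • v n) ≤ y) {ε : ℝ} (hε : 0 < ε) :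
    ∃ (x : M) (s : S.V), 0 ≤ s ∧ dist s 0 ≤ ε ∧
      ∀ n, M.completionPnorm (u n • (v n - (x : Completion M))) ≤ s := by
  have hu0 := partition_nonneg hu
  obtain ⟨δ, hδ, H⟩ := S.gluing u hu ε hε
  -- The tolerances `δ / 2 / 2 ^ n` sum to exactly `δ`, as the gluing axiom of `S` requires.
  have happrox : ∀ n, ∃ x : M,
      dist (M.completionPnorm (u n • (v n - (x : Completion M)))) 0 < δ / 2 / 2 ^ n := by
    intro n
    have hcont : Continuous fun z : Completion M =>
        dist (M.completionPnorm (u n • (v n - z))) 0 :=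
      (M.continuous_completionPnorm_smul_sub (u n) (v n)).dist continuous_const
    refine Completion.denseRange_coe.exists_mem_open (isOpen_lt hcont continuous_const) ⟨v n, ?_⟩
    have : M.completionPnorm 0 = 0 := (M.completionPnorm_eq_zero_iff 0).2 rfl
    simp only [Set.mem_ofPred_eq, sub_self, smul_zero, this, dist_self]
    positivity
  choose x hx using happrox
  simp only [M.completionPnorm_smul_of_nonneg (hu0 _)] at hx
  have hsum := hasSum_geometric_two' δ
  have hsummable : Summable fun n =>
      dist (act S.mul_eq (u n) (M.completionPnorm (v n - (x n : Completion M)))) 0 :=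
    Summable.of_nonneg_of_le (fun _ => dist_nonneg) (fun n => (hx n).le) hsum.summable
  obtain ⟨-, s, hs, hsε⟩ := H (fun n => M.completionPnorm (v n - (x n : Completion M)))
    (fun n => M.completionPnorm_nonneg _) hsummable
    (hasSum_le (fun n => (hx n).le) hsummable.hasSum hsum)
  have hle : ∀ n, M.completionPnorm (u n • (v n - (x n : Completion M))) ≤ s := fun n => by
    rw [M.completionPnorm_smul_of_nonneg (hu0 n)]
    exact hs.1 ⟨n, rfl⟩
  -- The errors are at most `s`, so the approximants are bounded by `y + s` and gluing in `M`
  -- applies.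
  have hbdd : OrderBounded (Set.range fun n => M.pnorm (u n • x n)) := by
    refine ⟨⟨y + s, ?_⟩, ⟨0, ?_⟩⟩
    · rintro _ ⟨n, rfl⟩
      have h1 := M.completionPnorm_add_le (u n • v n) (u n • ((x n : Completion M) - v n))
      rw [← smul_add, add_sub_cancel, ← Completion.coe_smul, completionPnorm_coe] at h1
      refine h1.trans (add_le_add (hy n) ?_)
      rw [smul_sub, completionPnorm_sub_comm, ← smul_sub]
      exact hle n
    · rintro _ ⟨n, rfl⟩
      exact M.pnorm_nonneg _
  obtain ⟨z, hz⟩ := M.gluing u x hu hbdd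
  refine ⟨z, s, (M.completionPnorm_nonneg _).trans (hle 0), hsε, fun n => ?_⟩
  rw [smul_sub, ← Completion.coe_smul, hz n, Completion.coe_smul, ← smul_sub]
  exact hle n

theorem completion_gluing (u : ℕ → S.U) (v : ℕ → Completion M) (hu : IsCountablePartition u 1)
    (hv : OrderBounded (Set.range fun n => M.completionPnorm (u n • v n))) :
    ∃ w : Completion M, ∀ n, u n • w = u n • v n := by
  obtain ⟨⟨y, hy⟩, -⟩ := hv
  have hu0 := partition_nonneg hu
  choose x s hs0 hsε hle using fun k : ℕ =>
    exists_approx_glue hu v (fun n => hy ⟨n, rfl⟩) (show (0 : ℝ) < (1 / 2) ^ k by positivity)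
  have hgeom : Tendsto (fun k : ℕ => (1 / 2 : ℝ) ^ k) atTop (𝓝 0) :=
    tendsto_pow_atTop_nhds_zero_of_lt_one (by norm_num) (by norm_num)
  have hs : Tendsto s atTop (𝓝 0) :=
    tendsto_iff_dist_tendsto_zero.2 (squeeze_zero (fun _ => dist_nonneg) hsε hgeom)
  have hdist : ∀ k l, dist (x k : Completion M) (x l) ≤ (1 / 2) ^ k + (1 / 2) ^ l := by
    intro k l
    -- On each piece both elements are close to `v n`; the bound does not depend on `n`, so it
    -- globalises.
    have h1 : M.completionPnorm ((x k : Completion M) - x l) ≤ s k + s l := by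
      refine le_of_forall_act_le hu (M.completionPnorm_nonneg _)
        (add_nonneg (hs0 k) (hs0 l)) fun n => ?_
      rw [← M.completionPnorm_smul_of_nonneg (hu0 n)]
      have h2 := M.completionPnorm_add_le (u n • ((x k : Completion M) - v n))
        (u n • (v n - (x l : Completion M)))
      rw [← smul_add, sub_add_sub_cancel] at h2
      refine h2.trans (add_le_add ?_ (hle l n))
      rw [smul_sub, completionPnorm_sub_comm, ← smul_sub]
      exact hle k n
    rw [completion_dist_eq]
    have h3 := S.metricRiesz.dist_mono _ _ (M.completionPnorm_nonneg _) h1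
    have h4 := S.metricRiesz.dist_add_zero_le (s k) (s l)
    linarith [hsε k, hsε l]
  have hcauchy : CauchySeq fun k => (x k : Completion M) := by
    refine cauchySeq_of_le_tendsto_0 (fun N : ℕ => (1 / 2 : ℝ) ^ N + (1 / 2) ^ N)
      (fun k l N hk hl => (hdist k l).trans (add_le_add ?_ ?_)) (by simpa using hgeom.add hgeom)
    · exact pow_le_pow_of_le_one (by norm_num) (by norm_num) hk
    · exact pow_le_pow_of_le_one (by norm_num) (by norm_num) hl
  obtain ⟨w, hw⟩ := cauchySeq_tendsto_of_complete hcauchy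
  refine ⟨w, fun n => ?_⟩
  have hcont := M.continuous_completionPnorm_smul_sub (u n) (v n)
  -- With `n` fixed, let `k` tend to infinity in `hle k n`.
  have h1 : M.completionPnorm (u n • (v n - w)) ≤ 0 :=
    le_of_tendsto_of_tendsto' ((hcont.tendsto w).comp hw) hs fun k => hle k n
  have h2 := (M.completionPnorm_eq_zero_iff _).1 (h1.antisymm (M.completionPnorm_nonneg _))
  rw [smul_sub, sub_eq_zero] at h2
  exact h2.symm

/-! ### The completion as a normed module. -/

variable (M)

/-- The completion of a normed module. -/
noncomputable def completion : NormedMod.{a, m} S where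
  carrier := Completion M
  pnorm := M.completionPnorm
  pnorm_nonneg := M.completionPnorm_nonneg
  pnorm_eq_zero_iff := M.completionPnorm_eq_zero_iff
  pnorm_add_le := M.completionPnorm_add_le
  pnorm_smul := M.completionPnorm_smul
  gluing := completion_gluing

/-- The canonical linear map of a normed module into its completion. -/
noncomputable def toCompletion : M →ₗ[S.U] M.completion where
  toFun v := (v : Completion M)
  map_add' := Completion.coe_add
  map_smul' := Completion.coe_smul

/-- The metric completion, with its own distance and with that of a normed module. -/
noncomputable def completionIsometryEquiv : Completion M ≃ᵢ M.completion where
  toEquiv := Equiv.refl (Completion M)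
  isometry_toFun := Isometry.of_dist_eq fun v w => (M.completion_dist_eq v w).symm

theorem isCompletion_completion : IsCompletion M M.completion M.toCompletion where
  -- The two distances agree by `completion_dist_eq`, so completeness is carried across the
  -- isometry.
  banach := M.completionIsometryEquiv.completeSpace_iff.1 inferInstance
  denseRange := M.completionIsometryEquiv.surjective.denseRange.comp Completion.denseRange_coe
    M.completionIsometryEquiv.continuous
  pnorm_map := M.completionPnorm_coe

end NormedMod

/-! ### Extension of linear maps to completions -/

section Extension

variable {A : Type*} [CommRing A] [Algebra ℝ A] [Lattice A] {S : MetricFStructure A}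

theorem Hom.ext_toLin {M N : NormedMod S} {R T : Hom M N} (h : R.toLin = T.toLin) : R = T := by
  cases R
  cases T
  congr

theorem Hom.continuous {M N : NormedMod S} (T : Hom M N) : Continuous T.toLin := by
  obtain ⟨w, hw⟩ := T.bounded
  exact NormedMod.continuous_of_bound T.toLin w hw.2

theorem continuous_of_pnorm_le {M N : NormedMod S} (T : M →ₗ[S.U] N)
    (h : ∀ v, N.pnorm (T v) ≤ M.pnorm v) : Continuous T :=
  NormedMod.continuous_of_bound T 1 fun v => by
    rw [one_act]
    exact h v

namespace IsCompletion

variable {M N B C : NormedMod S} {ι : M →ₗ[S.U] B} {κ : N →ₗ[S.U] C}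

theorem isometry (h : IsCompletion M B ι) : Isometry ι :=
  Isometry.of_dist_eq fun v w => by
    rw [NormedMod.dist_def, NormedMod.dist_def, ← map_sub, h.pnorm_map]

/-- Continuous linear maps out of a completion are determined by their values on the module. -/
theorem linearMap_ext (h : IsCompletion M B ι) {R T : B →ₗ[S.U] C} (hR : Continuous R)
    (hT : Continuous T) (hRT : ∀ v, R (ι v) = T (ι v)) : R = T :=
  DFunLike.coe_injective (h.denseRange.equalizer hR hT (funext hRT))

/-- Both sides are continuous in `x` and the order of `V` is closed, so density suffices and `w` is
unchanged. -/
theorem bound_of_bound (h : IsCompletion M B ι) {R : B →ₗ[S.U] C} (hR : Continuous R) {w : S.U}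
    (hw : ∀ v, C.pnorm (R (ι v)) ≤ act S.mul_eq w (M.pnorm v)) (x : B) :
    C.pnorm (R x) ≤ act S.mul_eq w (B.pnorm x) := by
  refine h.denseRange.induction_on x (isClosed_le (C.continuous_pnorm.comp hR)
    ((continuous_act_left w).comp B.continuous_pnorm)) fun v => ?_
  rw [h.pnorm_map]
  exact hw v

theorem exists_extension (h : IsCompletion M B ι) (hC : C.IsBanach) (T : M →ₗ[S.U] C)
    (hT : Continuous T) : ∃ R : B →ₗ[S.U] C, Continuous R ∧ ∀ v, R (ι v) = T v := by
  have : CompleteSpace C := hC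
  let f : M →L[S.U] C := ⟨T, hT⟩
  let e : M →L[S.U] B := ⟨ι, h.isometry.continuous⟩
  exact ⟨(f.extend e).toLinearMap, (f.extend e).continuous,
    f.extend_eq (e := e) h.denseRange h.isometry.isUniformInducing⟩

theorem exists_extension_pnorm_le (h : IsCompletion M B ι) (hC : C.IsBanach) (T : M →ₗ[S.U] C)
    (hT : ∀ v, C.pnorm (T v) ≤ M.pnorm v) :
    ∃ R : B →ₗ[S.U] C, (∀ x, C.pnorm (R x) ≤ B.pnorm x) ∧ ∀ v, R (ι v) = T v := by
  obtain ⟨R, hRc, hR⟩ := h.exists_extension hC T (continuous_of_pnorm_le T hT)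
  refine ⟨R, fun x => ?_, hR⟩
  have := h.bound_of_bound hRc (w := 1) (fun v => by rw [one_act, hR]; exact hT v) x
  rwa [one_act] at this

/-- Each embedding extends along the other; the two composites are the identity on a dense set. -/
theorem existsUnique_iso {κ : M →ₗ[S.U] C} (h : IsCompletion M B ι) (h' : IsCompletion M C κ) :
    ∃! Φ : B ≃ₗ[S.U] C, IsNormedModIso Φ ∧ ∀ v : M, Φ (ι v) = κ v := by
  obtain ⟨R, hRn, hR⟩ := h.exists_extension_pnorm_le h'.banach κ fun v => (h'.pnorm_map v).le
  obtain ⟨T, hTn, hT⟩ := h'.exists_extension_pnorm_le h.banach ι fun v => (h.pnorm_map v).le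
  have hRc := continuous_of_pnorm_le R hRn
  have hTc := continuous_of_pnorm_le T hTn
  have h1 : R ∘ₗ T = LinearMap.id :=
    h'.linearMap_ext (hRc.comp hTc) continuous_id fun v => by simp [hT, hR]
  have h2 : T ∘ₗ R = LinearMap.id :=
    h.linearMap_ext (hTc.comp hRc) continuous_id fun v => by simp [hT, hR]
  refine ⟨LinearEquiv.ofLinearMap R T h1 h2, ⟨⟨hRn, hTn⟩, hR⟩, fun Ψ hΨ => ?_⟩
  refine LinearEquiv.toLinearMap_injective ?_
  exact h.linearMap_ext (continuous_of_pnorm_le Ψ.toLinearMap hΨ.1.1) hRc fun v =>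
    (hΨ.2 v).trans (hR v).symm

/-- One inclusion restricts along `ι`, the other is density. The equality gives both the boundedness
of the extension and the equality of pointwise norms. -/
theorem boundSet_eq (h : IsCompletion M B ι) (h' : IsCompletion N C κ) {T : M →ₗ[S.U] N}
    {R : B →ₗ[S.U] C} (hRc : Continuous R) (hR : ∀ v, R (ι v) = κ (T v)) :
    boundSet R = boundSet T := by
  ext w
  refine and_congr_right fun _ => ⟨fun hw v => ?_, fun hw => h.bound_of_bound hRc fun v => ?_⟩
  · have := hw (ι v)
    rwa [hR, h'.pnorm_map, h.pnorm_map] at this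
  · rw [hR, h'.pnorm_map]
    exact hw v

theorem existsUnique_hom (h : IsCompletion M B ι) (h' : IsCompletion N C κ) (T : Hom M N) :
    ∃! R : Hom B C, ∀ v : M, R.toLin (ι v) = κ (T.toLin v) := by
  obtain ⟨R, hRc, hR⟩ := h.exists_extension h'.banach (κ ∘ₗ T.toLin)
    (h'.isometry.continuous.comp T.continuous)
  refine ⟨⟨R, ?_⟩, hR, fun R' hR' => Hom.ext_toLin ?_⟩
  · rw [h.boundSet_eq h' hRc hR]
    exact T.bounded
  · exact h.linearMap_ext R'.continuous hRc fun v => (hR' v).trans (hR v).symm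

theorem pnorm_hom_eq (h : IsCompletion M B ι) (h' : IsCompletion N C κ) {T : Hom M N}
    {R : Hom B C} (hU : DedekindComplete S.U) (hR : ∀ v, R.toLin (ι v) = κ (T.toLin v)) :
    R.pnorm hU = T.pnorm hU := by
  have h1 := R.isGLB_pnorm hU
  rw [h.boundSet_eq h' R.continuous hR] at h1
  exact h1.unique (T.isGLB_pnorm hU)

end IsCompletion

end Extension

end FMod

theorem mainTheorem8 {A : Type a} [CommRing A] [Algebra ℝ A] [Lattice A]
    (S : MetricFStructure A) :
    -- existence of the completion
    (∀ M : NormedMod.{a, m} S, ∃ (B : NormedMod.{a, m} S) (ι : M →ₗ[S.U] B), IsCompletion M B ι) ∧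
    -- uniqueness up to unique isomorphism
    (∀ (M : NormedMod.{a, m} S) (B : NormedMod.{a, b} S) (C : NormedMod.{a, c} S)
      (ι : M →ₗ[S.U] B) (κ : M →ₗ[S.U] C), IsCompletion M B ι → IsCompletion M C κ →
      ∃! Φ : B ≃ₗ[S.U] C, IsNormedModIso Φ ∧ ∀ v : M, Φ (ι v) = κ v) ∧
    -- unique extension of homomorphisms to the completions, and the norm of the extension
    (∀ (M : NormedMod.{a, m} S) (N : NormedMod.{a, n} S) (B : NormedMod.{a, b} S)
      (C : NormedMod.{a, c} S) (ι : M →ₗ[S.U] B) (κ : N →ₗ[S.U] C),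
      IsCompletion M B ι → IsCompletion N C κ → ∀ T : Hom M N,
      (∃! R : Hom B C, ∀ v : M, R.toLin (ι v) = κ (T.toLin v)) ∧
      ∀ hU : DedekindComplete S.U, ∀ R : Hom B C,
        (∀ v : M, R.toLin (ι v) = κ (T.toLin v)) → R.pnorm hU = T.pnorm hU) :=
  ⟨fun M => ⟨M.completion, M.toCompletion, M.isCompletion_completion⟩,
    fun _ _ _ _ _ h h' => h.existsUnique_iso h',
    fun _ _ _ _ _ _ h h' T => ⟨h.existsUnique_hom h' T, fun hU _ hR => h.pnorm_hom_eq h' hU hR⟩⟩
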